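/- A *well-quasi-order* (wqo) is a quasi-order $A$ in which every infinite sequence $(x_i)_{i\in\mathbb N}$ has $i<j$ with $x_i\le x_j$. For a wqo $A$, consider the trees of finite bad sequences ($x_i\not\le x_j$ for all $i<j$), of finite strictly decreasing sequences, and of finite sequences of pairwise incomparable elements, each rooted at the empty sequence, with extensions of a sequence lying below it. These trees have no infinite branch. The rank of a node is $r(s)=\sup\{r(t)+1 : t \text{ a proper extension of } s \text{ in the tree}\}$ (so leaves have rank $0$), and the rank of the tree is the rank of its root. The *maximal order type* $\mathbf o(A)$, the *height* $\mathbf h(A)$ and the *width* $\mathbf w(A)$ are the ranks of the tree of bad sequences, of strictly decreasing sequences, and of antichain sequences, respectively. For $n\in\mathbb N$ let $\Gamma_n$ be the wqo of $n$ pairwise incomparable elements. For wqos $(A_i)_{i\in I}$ indexed by a well-order $I$, the lexicographic sum $\sum_{i\in I}A_i$ is the disjoint union of the $A_i$, ordered by: $x\le y$ if $x\in A_i$, $y\in A_j$ with $i<j$, or $x,y\in A_i$ and $x\le_{A_i}y$. The lexicographic product $A\cdot B$ is the set of pairs $(a,b)$, $a\in A$, $b\in B$, with $(a,b)\le(a',b')$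 iff $b\le b'$ and ($b\equiv b'\Rightarrow a\le a'$), where $b\equiv b'$ means $b\le b'\le b$. Define wqos $H_{\omega^\alpha}$, for all ordinals $\alpha$, by recursion on $\alpha$: - $H_{\omega^0}=\Gamma_1$; - $H_{\omega^1}=\sum_{n<\omega}\Gamma_n$; - $H_{\omega^{\omega^\gamma}}=\sum_{\beta<\omega^\gamma}H_{\omega^\beta}$ for every $\gamma>0$; - $H_{\omega^\alpha}=H_{\omega^{\omega^{\alpha_1}}}\cdot H_{\omega^{\omega^{\alpha_2}}}\cdots H_{\omega^{\omega^{\alpha_n}}}$ (lexicographic product) if $\alpha=\omega^{\alpha_1}+\dots+\omega^{\alpha_n}$ with $\alpha_1\ge\dots\ge\alpha_n$ and $n>1$ (Cantor normal form). **Proposition.** For every ordinal $\alpha$, $$\mathbf h(H_{\omega^\alpha})=\mathbf w(H_{\omega^\alpha})=\mathbf o(H_{\omega^\alpha})=\omega^\alpha .$$ -/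

import Mathlib

universe u v

open Ordinal

namespace WqoInvariants

/-- A well-quasi-order, bundled with its underlying type. -/
structure Wqo : Type (u + 1) where
  carrier : Type u
  [preorder : Preorder carrier]
  [wqo : WellQuasiOrderedLE carrier]

instance : CoeSort Wqo.{u} (Type u) := ⟨Wqo.carrier⟩

instance (A : Wqo.{u}) : Preorder A := A.preorder

instance (A : Wqo.{u}) : WellQuasiOrderedLE A := A.wqo

/-! ### Ordinal invariants -/

/-- The finite sequences `x₁, …, xₙ` with `R xᵢ xⱼ` for all `i < j`. -/
abbrev SeqTree {A : Type u} (R : A → A → Prop) : Type u :=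
  {l : List A // l.Pairwise R}

/-- `SeqTree.Below t s` means that `t` lies strictly below `s` in the tree, i.e. that `s` is a
proper prefix of `t`. -/
def SeqTree.Below {A : Type u} {R : A → A → Prop} (t s : SeqTree R) : Prop :=
  s.1 <+: t.1 ∧ s.1 ≠ t.1

/-- The empty sequence. -/
def SeqTree.root {A : Type u} (R : A → A → Prop) : SeqTree R :=
  ⟨[], List.Pairwise.nil⟩

/-- If all sequences counted in the tree are bad sequences of a wqo, the tree has no infinite
branch. -/
theorem SeqTree.wellFounded_below {A : Wqo.{u}} {R : A → A → Prop}
    (hR : ∀ x y, R x y → ¬ x ≤ y) :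
    WellFounded (SeqTree.Below (R := R)) := by
  rw [wellFounded_iff_isEmpty_descending_chain]
  refine ⟨fun ⟨f, hf⟩ ↦ ?_⟩
  have hstep : ∀ n, (f n).1 <+: (f (n + 1)).1 ∧ (f n).1 ≠ (f (n + 1)).1 := hf
  have hlt : ∀ n, (f n).1.length < (f (n + 1)).1.length := fun n ↦
    lt_of_le_of_ne (hstep n).1.length_le fun h ↦ (hstep n).2 ((hstep n).1.eq_of_length h)
  have hlen : ∀ n, n ≤ (f n).1.length := by
    intro n
    induction n with
    | zero => exact Nat.zero_le _
    | succ k ih => have := hlt k; omega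
  have hpre : ∀ m n, m ≤ n → (f m).1 <+: (f n).1 := by
    intro m n h
    induction n, h using Nat.le_induction with
    | base => exact List.prefix_rfl
    | succ k _ ih => exact ih.trans (hstep k).1
  have hl : ∀ n, n < (f (n + 1)).1.length := fun n ↦ hlen (n + 1)
  obtain ⟨m, n, hmn, hle⟩ :=
    wellQuasiOrdered_le (α := A) fun n ↦ (f (n + 1)).1[n]'(hl n)
  have hp := hpre (m + 1) (n + 1) (by omega)
  have hm : m < (f (n + 1)).1.length := lt_of_lt_of_le (hl m) hp.length_le
  have hget : (f (m + 1)).1[m]'(hl m) = (f (n + 1)).1[m]'hm := hp.getElem (hl m)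
  have hrel := List.pairwise_iff_getElem.1 (f (n + 1)).2 m n hm (hl n) hmn
  refine hR _ _ hrel ?_
  rw [← hget]
  exact hle

/-- The rank of the root of the tree of `R`-sequences, where the rank of a node is the supremum of
the successors of the ranks of the nodes strictly below it. -/
noncomputable def treeRank {A : Wqo.{u}} (R : A → A → Prop) (hR : ∀ x y, R x y → ¬ x ≤ y) :
    Ordinal.{u} :=
  ((SeqTree.wellFounded_below hR).apply (SeqTree.root R)).rank

/-- Maximal order type: the rank of the tree of bad sequences. -/
noncomputable def maxOrderType (A : Wqo.{u}) : Ordinal.{u} :=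
  treeRank (A := A) (fun x y ↦ ¬ x ≤ y) fun _ _ h ↦ h

/-- Height: the rank of the tree of strictly decreasing sequences. -/
noncomputable def height (A : Wqo.{u}) : Ordinal.{u} :=
  treeRank (A := A) (fun x y ↦ y < x) fun _ _ h ↦ not_le_of_gt h

/-- Width: the rank of the tree of antichain sequences. -/
noncomputable def width (A : Wqo.{u}) : Ordinal.{u} :=
  treeRank (A := A) (fun x y ↦ IncompRel (· ≤ ·) x y) fun _ _ h ↦ h.1

/-! ### Operations on well-quasi-orders -/

/-- The underlying type of the antichain of size `n`. -/
structure Gamma.Carrier (n : ℕ) : Type u where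
  idx : Fin n

instance (n : ℕ) : Preorder (Gamma.Carrier.{u} n) where
  le := Eq
  le_refl := fun _ ↦ rfl
  le_trans := fun _ _ _ ↦ Eq.trans

instance (n : ℕ) : WellQuasiOrderedLE (Gamma.Carrier.{u} n) :=
  have : Finite (Gamma.Carrier.{u} n) :=
    Finite.of_injective Gamma.Carrier.idx fun ⟨_⟩ ⟨_⟩ h ↦ congrArg _ h
  Finite.to_wellQuasiOrderedLE

/-- `Γₙ`: `n` pairwise incomparable elements. -/
def Gamma (n : ℕ) : Wqo.{u} where
  carrier := Gamma.Carrier n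

theorem wellQuasiOrderedLE_sigmaLex {ι : Type v} [LinearOrder ι] [WellFoundedLT ι]
    (A : ι → Wqo.{u}) : WellQuasiOrderedLE (Σₗ i, A i) := by
  refine ⟨fun f ↦ ?_⟩
  obtain ⟨g, hg⟩ := (wellQuasiOrdered_le (α := ι)).exists_monotone_subseq fun n ↦ (f n).1
  by_cases h : ∃ k, (f (g 0)).1 < (f (g k)).1
  · obtain ⟨k, hk⟩ := h
    refine ⟨g 0, g k, g.strictMono (Nat.pos_of_ne_zero ?_), Sigma.Lex.left _ _ hk⟩
    rintro rfl
    exact lt_irrefl _ hk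
  · push Not at h
    have heq : ∀ k, (f (g k)).1 = (f (g 0)).1 := fun k ↦
      le_antisymm (h k) (hg 0 k (Nat.zero_le k))
    have hex : ∀ k, ∃ a : A (f (g 0)).1, f (g k) = ⟨(f (g 0)).1, a⟩ := by
      intro k
      have hk := heq k
      generalize (f (g 0)).1 = i at hk
      generalize f (g k) = x at hk
      obtain ⟨j, a⟩ := x
      obtain rfl : j = i := hk
      exact ⟨a, rfl⟩
    choose a ha using hex
    obtain ⟨m, n, hmn, hle⟩ := wellQuasiOrdered_le a
    refine ⟨g m, g n, g.strictMono hmn, ?_⟩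
    rw [ha m, ha n]
    exact Sigma.Lex.right _ _ hle

/-- The lexicographic sum of a family of wqos along a well-order `ι`: pairs `(i, a)` with
`a ∈ A i`, where `(i, a) ≤ (j, b)` iff `i < j`, or `i = j` and `a ≤ b`. -/
def lexSum {ι : Type v} [LinearOrder ι] [WellFoundedLT ι] (A : ι → Wqo.{u}) :
    Wqo.{max v u} where
  carrier := Σₗ i, A i
  wqo := wellQuasiOrderedLE_sigmaLex A

/-- The underlying type of the lexicographic product. -/
structure LexProd (A B : Type u) : Type u where
  fst : A
  snd : B

/-- `(a, b) ≤ (a', b')` iff `b ≤ b'`, and `a ≤ a'` in case `b` and `b'` are equivalent; the second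
component has priority. -/
instance (A B : Type u) [Preorder A] [Preorder B] : Preorder (LexProd A B) where
  le x y := x.snd ≤ y.snd ∧ (AntisymmRel (· ≤ ·) x.snd y.snd → x.fst ≤ y.fst)
  le_refl x := ⟨le_rfl, fun _ ↦ le_rfl⟩
  le_trans x y z hxy hyz := ⟨hxy.1.trans hyz.1, fun h ↦
    (hxy.2 ⟨hxy.1, hyz.1.trans h.2⟩).trans (hyz.2 ⟨hyz.1, h.2.trans hxy.1⟩)⟩

instance (A B : Type u) [Preorder A] [Preorder B] [WellQuasiOrderedLE A] [WellQuasiOrderedLE B] :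
    WellQuasiOrderedLE (LexProd A B) := by
  refine ⟨fun f ↦ ?_⟩
  obtain ⟨m, n, hmn, h⟩ :=
    (wellQuasiOrdered_le (α := A)).prod (wellQuasiOrdered_le (α := B))
      fun n ↦ ((f n).fst, (f n).snd)
  exact ⟨m, n, hmn, h.2, fun _ ↦ h.1⟩

/-- The lexicographic product `A · B`. -/
def lexProd (A B : Wqo.{u}) : Wqo.{u} where
  carrier := LexProd A B

/-- The iterated lexicographic product `A₁ · A₂ ⋯ Aₙ` of a list of wqos. -/
def lexProdList : List Wqo.{u} → Wqo.{u}
  | [] => Gamma 1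
  | [A] => A
  | A :: B :: l => lexProd A (lexProdList (B :: l))

/-! ### Cantor normal form -/

theorem sub_opow_log_lt {α : Ordinal.{u}} (h : α ≠ 0) : α - ω ^ log ω α < α :=
  (isLeast_sub_lt_omega0_opow_log h).1

open Classical in
/-- The list `[α₁, …, αₙ]` of exponents of the Cantor normal form
`α = ω ^ α₁ + ⋯ + ω ^ αₙ`, `α₁ ≥ ⋯ ≥ αₙ`. -/
noncomputable def cnfExponents (α : Ordinal.{u}) : List Ordinal.{u} :=
  if α = 0 then [] else log ω α :: cnfExponents (α - ω ^ log ω α)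
termination_by α
decreasing_by exact sub_opow_log_lt (by assumption)

theorem cnfExponents_zero : cnfExponents (0 : Ordinal.{u}) = [] := by
  rw [cnfExponents, if_pos rfl]

theorem cnfExponents_ne_zero {α : Ordinal.{u}} (h : α ≠ 0) :
    cnfExponents α = log ω α :: cnfExponents (α - ω ^ log ω α) := by
  rw [cnfExponents, if_neg h]

theorem le_log_of_mem_cnfExponents {α β : Ordinal.{u}} (hβ : β ∈ cnfExponents α) :
    β ≤ log ω α := by
  induction α using WellFoundedLT.induction with
  | ind α ih =>
    by_cases h : α = 0
    · simp [h, cnfExponents_zero] at hβ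
    · rw [cnfExponents_ne_zero h, List.mem_cons] at hβ
      rcases hβ with rfl | hβ
      · exact le_rfl
      · exact (ih _ (sub_opow_log_lt h) hβ).trans (log_mono_right ω (sub_le_self _ _))

/-- `cnfExponents α` is indeed the list of exponents of the Cantor normal form of `α`. -/
theorem cnfExponents_spec (α : Ordinal.{u}) :
    (cnfExponents α).Pairwise (· ≥ ·) ∧ ((cnfExponents α).map (ω ^ ·)).sum = α := by
  induction α using WellFoundedLT.induction with
  | ind α ih =>
    by_cases h : α = 0
    · simp [h, cnfExponents_zero]
    · obtain ⟨h1, h2⟩ := ih _ (sub_opow_log_lt h)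
      rw [cnfExponents_ne_zero h]
      refine ⟨List.pairwise_cons.2 ⟨fun β hβ ↦ ?_, h1⟩, ?_⟩
      · exact (le_log_of_mem_cnfExponents hβ).trans (log_mono_right ω (sub_le_self _ _))
      · rw [List.map_cons, List.sum_cons, h2]
        exact Ordinal.add_sub_cancel_of_le (opow_log_le_self ω h)

theorem opow_lt_of_mem_cnfExponents {α β : Ordinal.{u}} (h : ¬ ∃ γ : Ordinal.{u}, α = ω ^ γ)
    (hβ : β ∈ cnfExponents α) : ω ^ β < α := by
  have h0 : α ≠ 0 := by
    rintro rfl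
    simp [cnfExponents_zero] at hβ
  refine lt_of_le_of_ne ?_ fun he ↦ h ⟨β, he.symm⟩
  exact (opow_le_opow_right omega0_pos (le_log_of_mem_cnfExponents hβ)).trans
    (opow_log_le_self ω h0)

/-! ### The family -/

open Classical in
/-- The wqo `H_{ω ^ α}`:
* `H_{ω ^ 0} = Γ₁`;
* `H_{ω ^ 1} = ∑_{n < ω} Γₙ`;
* `H_{ω ^ (ω ^ γ)} = ∑_{β < ω ^ γ} H_{ω ^ β}` for `γ > 0`;
* `H_{ω ^ α} = H_{ω ^ (ω ^ α₁)} · ⋯ · H_{ω ^ (ω ^ αₙ)}` if `α = ω ^ α₁ + ⋯ + ω ^ αₙ` is in Cantor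
  normal form with `n > 1`. -/
noncomputable def famH (α : Ordinal.{u}) : Wqo.{u} :=
  if α = 0 then Gamma 1
  else if α = 1 then lexSum fun n : ℕ ↦ Gamma n
  else if h : ∃ γ : Ordinal.{u}, α = ω ^ γ then lexSum fun β : α.ToType ↦ famH (ToType.toOrd β : Ordinal.{u})
  else lexProdList ((cnfExponents α).attach.map fun e ↦ famH (ω ^ e.1))
termination_by α
decreasing_by
  · exact (ToType.toOrd β).2
  · exact opow_lt_of_mem_cnfExponents h e.2

end WqoInvariants

namespace WqoInvariants

/-! ### The natural sum of ordinals -/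

/-! Decreasing sequences and antichains are bad sequences, so it suffices to bound the bad-sequence
rank above by `ω ^ α` and the other two ranks below by it. This package, `HasRank`, is proved by
induction on `α`. Ranks are handled through residuals: after choosing `x`, the rest of the sequence
lives in the set of `y` with `R x y`. Above, the rank of a union is at most the natural sum of the
ranks, and powers of `ω` are closed under natural sums (`natAdd_lt_omega0_opow`). A bad sequence in
a lexicographic sum never climbs to a higher summand, so its residual splits into lower summands and
one summand of smaller exponent. In a product, it splits into a residual of the second factor and
part of one fibre. Below, sequences are concatenated fibre by fibre, which gives ordinary sums and
products; at limit exponents a single summand already exceeds any given smaller rank. -/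

/-- The natural (Hessenberg) sum of two ordinals. -/
noncomputable def natAdd (a b : Ordinal.{u}) : Ordinal.{u} :=
  max (⨆ x : Set.Iio a, Order.succ (natAdd x.1 b)) (⨆ x : Set.Iio b, Order.succ (natAdd a x.1))
termination_by (a, b)
decreasing_by
  · exact Prod.Lex.left _ _ x.2
  · exact Prod.Lex.right _ x.2

theorem natAdd_le_iff {a b c : Ordinal.{u}} :
    natAdd a b ≤ c ↔ (∀ x < a, natAdd x b < c) ∧ ∀ y < b, natAdd a y < c := by
  rw [natAdd, max_le_iff, Ordinal.iSup_le_iff, Ordinal.iSup_le_iff]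
  simp [Subtype.forall]

theorem natAdd_lt_natAdd_right {a b c : Ordinal.{u}} (h : a < b) : natAdd a c < natAdd b c :=
  (natAdd_le_iff.1 le_rfl).1 a h

theorem natAdd_lt_natAdd_left {a b c : Ordinal.{u}} (h : a < b) : natAdd c a < natAdd c b :=
  (natAdd_le_iff.1 le_rfl).2 a h

theorem natAdd_zero_le (a : Ordinal.{u}) : natAdd a 0 ≤ a := by
  induction a using WellFoundedLT.induction with
  | ind a ih =>
    exact natAdd_le_iff.2 ⟨fun x hx ↦ (ih x hx).trans_lt hx, fun y hy ↦ absurd hy not_lt_zero⟩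

theorem natAdd_natCast_le (m n : ℕ) : natAdd (m : Ordinal.{u}) n ≤ (m + n : ℕ) := by
  induction hk : m + n using Nat.strong_induction_on generalizing m n with
  | h k ih =>
    refine natAdd_le_iff.2 ⟨fun x hx ↦ ?_, fun y hy ↦ ?_⟩
    · obtain ⟨i, rfl⟩ := lt_omega0.1 (hx.trans (natCast_lt_omega0 m))
      rw [Nat.cast_lt] at hx
      exact (ih (i + n) (by omega) i n rfl).trans_lt (Nat.cast_lt.2 (by omega))
    · obtain ⟨i, rfl⟩ := lt_omega0.1 (hy.trans (natCast_lt_omega0 n))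
      rw [Nat.cast_lt] at hy
      exact (ih (m + i) (by omega) m i rfl).trans_lt (Nat.cast_lt.2 (by omega))

/-- Division by `ω ^ a` behaves lexicographically: lowering an argument lowers its quotient, or
keeps it and lowers its remainder. In the first case closure keeps the sum of remainders below `ω ^
a`, so it cannot make up for the lost quotient. -/
theorem natAdd_le_of_closed {a : Ordinal.{u}}
    (h : ∀ x < ω ^ a, ∀ y < ω ^ a, natAdd x y < ω ^ a) (x y : Ordinal.{u}) :
    natAdd x y ≤ ω ^ a * natAdd (x / ω ^ a) (y / ω ^ a) + natAdd (x % ω ^ a) (y % ω ^ a) := by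
  have hpos : (ω ^ a : Ordinal.{u}) ≠ 0 := opow_ne_zero a omega0_ne_zero
  have key : ∀ {q q' r r' : Ordinal.{u}}, r < ω ^ a → q < q' →
      ω ^ a * q + r < ω ^ a * q' + r' := fun {q q' r r'} hr hq ↦
    calc ω ^ a * q + r < ω ^ a * q + ω ^ a := (add_lt_add_iff_left _).2 hr
      _ = ω ^ a * (q + 1) := by rw [mul_add_one]
      _ ≤ ω ^ a * q' := mul_le_mul_right (Order.add_one_le_of_lt hq) _
      _ ≤ _ := le_self_add
  have split : ∀ {x' x : Ordinal.{u}}, x' < x → x' / ω ^ a < x / ω ^ a ∨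
      x' / ω ^ a = x / ω ^ a ∧ x' % ω ^ a < x % ω ^ a := by
    intro x' x hx
    rcases (div_le_left hx.le (ω ^ a)).lt_or_eq with hlt | heq
    · exact Or.inl hlt
    · refine Or.inr ⟨heq, ?_⟩
      rw [← div_add_mod x (ω ^ a), ← div_add_mod x' (ω ^ a), heq] at hx
      exact (add_lt_add_iff_left _).1 hx
  induction x using WellFoundedLT.induction generalizing y with
  | ind x ihx =>
  induction y using WellFoundedLT.induction with
  | ind y ihy =>
    refine natAdd_le_iff.2 ⟨fun x' hx ↦ (ihx x' hx y).trans_lt ?_,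
      fun y' hy ↦ (ihy y' hy).trans_lt ?_⟩
    · rcases split hx with hlt | ⟨heq, hlt⟩
      · exact key (h _ (mod_lt _ hpos) _ (mod_lt _ hpos)) (natAdd_lt_natAdd_right hlt)
      · rw [heq]
        exact (add_lt_add_iff_left _).2 (natAdd_lt_natAdd_right hlt)
    · rcases split hy with hlt | ⟨heq, hlt⟩
      · exact key (h _ (mod_lt _ hpos) _ (mod_lt _ hpos)) (natAdd_lt_natAdd_left hlt)
      · rw [heq]
        exact (add_lt_add_iff_left _).2 (natAdd_lt_natAdd_left hlt)

/-- With `b` the logarithm of the larger argument, both quotients by `ω ^ b` are finite and `ω ^ b`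
is closed by induction, so the sum stays below a finite multiple of `ω ^ b`. -/
theorem natAdd_lt_omega0_opow {a x y : Ordinal.{u}} (hx : x < ω ^ a) (hy : y < ω ^ a) :
    natAdd x y < ω ^ a := by
  induction a using WellFoundedLT.induction generalizing x y with
  | ind a ih =>
  rcases eq_or_ne a 0 with rfl | ha
  · rw [opow_zero, Order.lt_one_iff] at hx hy
    subst hx hy
    rw [opow_zero]
    exact (natAdd_zero_le 0).trans_lt zero_lt_one
  · set b := log ω (max x y) with hb
    have hba : b < a := lt_log_of_lt_opow ha (max_lt hx hy)
    have hpos : (ω ^ b : Ordinal.{u}) ≠ 0 := opow_ne_zero b omega0_ne_zero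
    have hfin : ∀ z ≤ max x y, ∃ n : ℕ, z / ω ^ b = n := fun z hz ↦ by
      refine lt_omega0.1 ?_
      rw [← lt_mul_iff_div_lt hpos, ← opow_succ]
      exact hz.trans_lt (lt_opow_succ_log_self one_lt_omega0 _)
    obtain ⟨m, hm⟩ := hfin x (le_max_left _ _)
    obtain ⟨n, hn⟩ := hfin y (le_max_right _ _)
    have hcl := fun x hx y hy ↦ @ih b hba x y hx hy
    calc natAdd x y ≤ _ := natAdd_le_of_closed hcl x y
      _ < ω ^ b * natAdd (x / ω ^ b) (y / ω ^ b) + ω ^ b :=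
        (add_lt_add_iff_left _).2 (hcl _ (mod_lt _ hpos) _ (mod_lt _ hpos))
      _ ≤ ω ^ b * (m + n : ℕ) + ω ^ b := by
        rw [hm, hn]
        gcongr
        exact natAdd_natCast_le m n
      _ = ω ^ b * (m + n + 1 : ℕ) := by rw [Nat.cast_succ, mul_add_one]
      _ < ω ^ a := opow_mul_lt_opow (natCast_lt_omega0 _) hba

theorem natAdd_lt_omega0_opow_mul {a c x y : Ordinal.{u}} (hx : x < ω ^ a * c) (hy : y < ω ^ a) :
    natAdd x y < ω ^ a * c := by
  have hpos : (ω ^ a : Ordinal.{u}) ≠ 0 := opow_ne_zero a omega0_ne_zero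
  calc natAdd x y ≤ _ := natAdd_le_of_closed (fun _ hx _ hy ↦ natAdd_lt_omega0_opow hx hy) x y
    _ < ω ^ a * natAdd (x / ω ^ a) (y / ω ^ a) + ω ^ a :=
      (add_lt_add_iff_left _).2 (natAdd_lt_omega0_opow (mod_lt _ hpos) (mod_lt _ hpos))
    _ ≤ ω ^ a * (x / ω ^ a) + ω ^ a := by
      rw [div_eq_zero_of_lt hy]
      gcongr
      exact natAdd_zero_le _
    _ = ω ^ a * (x / ω ^ a + 1) := by rw [mul_add_one]
    _ ≤ ω ^ a * c := mul_le_mul_right (Order.add_one_le_of_lt ((lt_mul_iff_div_lt hpos).1 hx)) _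

/-! ### Bounds on the rank of the tree of sequences in a set -/

section Rank

variable {A B : Type u} {R : A → A → Prop} {Q : B → B → Prop}

/-- The tree of `R`-sequences in `S` has rank at most `δ`. -/
def RankLE (R : A → A → Prop) (S : Set A) (δ : Ordinal.{u}) : Prop :=
  ∀ x ∈ S, ∃ δ' : Ordinal.{u}, ∃ _ : δ' < δ, RankLE R {y ∈ S | R x y} δ'
termination_by δ

/-- The tree of `R`-sequences in `S` has rank at least `δ`. -/
def RankGE (R : A → A → Prop) (S : Set A) (δ : Ordinal.{u}) : Prop :=
  ∀ δ' : Ordinal.{u}, ∀ _ : δ' < δ, ∃ x ∈ S, RankGE R {y ∈ S | R x y} δ'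
termination_by δ

theorem rankLE_iff {S : Set A} {δ : Ordinal.{u}} :
    RankLE R S δ ↔ ∀ x ∈ S, ∃ δ' < δ, RankLE R {y ∈ S | R x y} δ' := by
  rw [RankLE]
  simp only [exists_prop]

theorem rankGE_iff {S : Set A} {δ : Ordinal.{u}} :
    RankGE R S δ ↔ ∀ δ' < δ, ∃ x ∈ S, RankGE R {y ∈ S | R x y} δ' := by
  rw [RankGE]

/-- Upper bounds on ranks are transported along a simulation. -/
theorem RankLE.of_rel {S : Set A} {T : Set B} {δ : Ordinal.{u}} (h : RankLE R S δ)
    (C : B → A → Prop) (hT : ∀ y ∈ T, ∃ x ∈ S, C y x)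
    (hC : ∀ y y' x x', C y x → C y' x' → Q y y' → R x x') : RankLE Q T δ := by
  induction δ using WellFoundedLT.induction generalizing S T with
  | ind δ ih =>
    refine rankLE_iff.2 fun y hy ↦ ?_
    obtain ⟨x, hx, hyx⟩ := hT y hy
    obtain ⟨δ', hδ, hS⟩ := rankLE_iff.1 h x hx
    refine ⟨δ', hδ, ih δ' hδ hS fun y' hy' ↦ ?_⟩
    obtain ⟨x', hx', hyx'⟩ := hT y' hy'.1
    exact ⟨x', ⟨hx', hC _ _ _ _ hyx hyx' hy'.2⟩, hyx'⟩

theorem RankLE.mono {S T : Set A} {δ ε : Ordinal.{u}} (h : RankLE R S δ) (hT : T ⊆ S)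
    (hδ : δ ≤ ε) : RankLE R T ε := by
  have h' : RankLE R T δ := h.of_rel (· = ·) (fun y hy ↦ ⟨y, hT hy, rfl⟩) (by grind)
  exact rankLE_iff.2 fun x hx ↦
    (rankLE_iff.1 h' x hx).imp fun _ h ↦ ⟨h.1.trans_le hδ, h.2⟩

theorem RankGE.of_map {S : Set A} {T : Set B} {δ : Ordinal.{u}} (h : RankGE R S δ)
    (f : A → B) (hT : ∀ x ∈ S, f x ∈ T) (hf : ∀ x y, R x y → Q (f x) (f y)) : RankGE Q T δ := by
  induction δ using WellFoundedLT.induction generalizing S T with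
  | ind δ ih =>
    refine rankGE_iff.2 fun δ' hδ ↦ ?_
    obtain ⟨x, hx, hS⟩ := rankGE_iff.1 h δ' hδ
    exact ⟨f x, hT x hx, ih δ' hδ hS fun y hy ↦ ⟨hT y hy.1, hf _ _ hy.2⟩⟩

theorem RankGE.mono {S T : Set A} {δ ε : Ordinal.{u}} (h : RankGE R S δ) (hT : S ⊆ T)
    (hδ : ε ≤ δ) : RankGE R T ε := by
  have h' : RankGE R T δ := h.of_map id hT fun _ _ ↦ id
  exact rankGE_iff.2 fun δ' hδ' ↦ rankGE_iff.1 h' δ' (hδ'.trans_le hδ)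

/-- Each choice lowers the rank of the part it comes from and does not enlarge the other; `natAdd`
is strictly monotone in both arguments. -/
theorem RankLE.union {S T : Set A} {δ ε : Ordinal.{u}} (hS : RankLE R S δ) (hT : RankLE R T ε) :
    RankLE R (S ∪ T) (natAdd δ ε) := by
  induction δ using WellFoundedLT.induction generalizing S T ε with
  | ind δ ihδ =>
  induction ε using WellFoundedLT.induction generalizing S T with
  | ind ε ihε =>
    refine rankLE_iff.2 fun x hx ↦ ?_
    rcases hx with hx | hx
    · obtain ⟨δ', hδ, hS'⟩ := rankLE_iff.1 hS x hx
      exact ⟨_, natAdd_lt_natAdd_right hδ, (ihδ δ' hδ hS' hT).mono (by grind) le_rfl⟩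
    · obtain ⟨ε', hε, hT'⟩ := rankLE_iff.1 hT x hx
      exact ⟨_, natAdd_lt_natAdd_left hε, (ihε ε' hε hS hT').mono (by grind) le_rfl⟩

/-- A sequence in `S` can be followed by any sequence in `T`. What is played last is the left
summand, hence `ε + δ`. -/
theorem RankGE.union {S T : Set A} {δ ε : Ordinal.{u}} (hS : RankGE R S δ) (hT : RankGE R T ε)
    (h : ∀ x ∈ S, ∀ y ∈ T, R x y) : RankGE R (S ∪ T) (ε + δ) := by
  induction δ using WellFoundedLT.induction generalizing S with
  | ind δ ih =>
    refine rankGE_iff.2 fun η hη ↦ ?_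
    rcases lt_or_ge η ε with hlt | hge
    · obtain ⟨x, hx, hx'⟩ := rankGE_iff.1 hT η hlt
      exact ⟨x, Or.inr hx, hx'.mono (by grind) le_rfl⟩
    · obtain ⟨δ', rfl⟩ := exists_add_of_le hge
      have hδ := (add_lt_add_iff_left _).1 hη
      obtain ⟨x, hx, hS'⟩ := rankGE_iff.1 hS δ' hδ
      exact ⟨x, Or.inl hx, (ih δ' hδ hS' fun y hy ↦ h y hy.1).mono (by grind) le_rfl⟩

theorem rankGE_of_pairwise (l : List A) (hl : l.Pairwise R) :
    RankGE R {x | x ∈ l} (l.length : Ordinal.{u}) := by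
  induction l with
  | nil => exact rankGE_iff.2 fun δ hδ ↦ absurd hδ (by simp)
  | cons a l ih =>
    rw [List.pairwise_cons] at hl
    refine rankGE_iff.2 fun δ hδ ↦ ⟨a, by simp, (ih hl.2).mono (fun x hx ↦ ⟨?_, hl.1 x hx⟩) ?_⟩
    · exact List.mem_cons_of_mem a hx
    · rw [List.length_cons, Nat.cast_succ] at hδ
      exact Order.lt_add_one_iff.1 hδ

theorem rankLE_finset (hR : ∀ x, ¬ R x x) (s : Finset A) :
    RankLE R (s : Set A) (s.card : Ordinal.{u}) := by
  classical
  induction s using Finset.strongInduction with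
  | H s ih =>
    refine rankLE_iff.2 fun x hx ↦ ?_
    refine ⟨_, ?_, (ih _ (Finset.erase_ssubset hx)).mono (fun y hy ↦ ?_) le_rfl⟩
    · exact_mod_cast Finset.card_erase_lt_of_mem hx
    · refine Finset.mem_coe.2 (Finset.mem_erase.2 ⟨?_, hy.1⟩)
      rintro rfl
      exact hR _ hy.2

end Rank

/-! ### Comparison with the rank of the tree -/

section TreeRank

variable {A : Wqo.{u}} {R : A → A → Prop}

/-- The subtree at `s` depends only on the set of elements that may still be appended. A proper
extension passes through a one-element extension `s'`, whose rank bounds that of everything below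
it. -/
theorem SeqTree.rank_le (hR : ∀ x y, R x y → ¬ x ≤ y) {δ : Ordinal.{u}} (s : SeqTree R)
    (h : RankLE R {y | ∀ x ∈ s.1, R x y} δ) :
    ((SeqTree.wellFounded_below hR).apply s).rank ≤ δ := by
  induction δ using WellFoundedLT.induction generalizing s with
  | ind δ ih =>
    rw [Acc.rank_eq]
    refine Ordinal.iSup_le_iff.2 fun ⟨⟨t, ht⟩, ⟨l, hl⟩, hne⟩ ↦ Order.succ_le_of_lt ?_
    cases l with
    | nil => exact absurd (by simpa using hl) hne
    | cons x l =>
      dsimp only at hl hne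
      subst hl
      have hx : ∀ z ∈ s.1, R z x := fun z hz ↦
        (List.pairwise_append.1 ht).2.2 z hz x List.mem_cons_self
      obtain ⟨δ', hδ, hx'⟩ := rankLE_iff.1 h x hx
      have hpre : s.1 ++ [x] <+: s.1 ++ x :: l := ⟨l, by simp⟩
      let s' : SeqTree R := ⟨s.1 ++ [x], ht.sublist hpre.sublist⟩
      have hs' := ih δ' hδ s' (hx'.mono (fun y hy ↦
        ⟨fun z hz ↦ hy z (by simp [s', hz]), hy x (by simp [s'])⟩) le_rfl)
      refine lt_of_le_of_lt (le_trans ?_ hs') hδ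
      cases l with
      | nil => exact le_rfl
      | cons z l =>
        exact (Acc.rank_lt_of_rel ((SeqTree.wellFounded_below hR).apply s')
          ⟨hpre, by simp [s']⟩).le

theorem SeqTree.le_rank (hR : ∀ x y, R x y → ¬ x ≤ y) {δ : Ordinal.{u}} (s : SeqTree R)
    (h : RankGE R {y | ∀ x ∈ s.1, R x y} δ) :
    δ ≤ ((SeqTree.wellFounded_below hR).apply s).rank := by
  induction δ using WellFoundedLT.induction generalizing s with
  | ind δ ih =>
    refine le_of_forall_lt fun δ' hδ ↦ ?_
    obtain ⟨x, hx, hx'⟩ := rankGE_iff.1 h δ' hδ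
    let s' : SeqTree R := ⟨s.1 ++ [x], List.pairwise_append.2
      ⟨s.2, List.pairwise_singleton _ _, fun z hz y hy ↦ by
        rw [List.mem_singleton.1 hy]; exact hx z hz⟩⟩
    have hs' := ih δ' hδ s' (hx'.mono (fun y hy z hz ↦ by
      rcases List.mem_append.1 hz with hz | hz
      · exact hy.1 z hz
      · rw [List.mem_singleton.1 hz]; exact hy.2) le_rfl)
    exact hs'.trans_lt (Acc.rank_lt_of_rel ((SeqTree.wellFounded_below hR).apply s)
      ⟨List.prefix_append _ _, by simp [s']⟩)

theorem treeRank_le (hR : ∀ x y, R x y → ¬ x ≤ y) {δ : Ordinal.{u}}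
    (h : RankLE R Set.univ δ) : treeRank R hR ≤ δ :=
  SeqTree.rank_le hR _ (h.mono (Set.subset_univ _) le_rfl)

theorem le_treeRank (hR : ∀ x y, R x y → ¬ x ≤ y) {δ : Ordinal.{u}}
    (h : RankGE R Set.univ δ) : δ ≤ treeRank R hR :=
  SeqTree.le_rank hR _ (h.mono (fun x _ ↦ by simp [SeqTree.root]) le_rfl)

end TreeRank

/-! ### Lexicographic products -/

section LexProd

variable {A B : Wqo.{u}}

theorem RankGE.lexProd {P : A → A → Prop} {Q : B → B → Prop}
    {R : lexProd A B → lexProd A B → Prop}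
    (hP : ∀ a a' b, P a a' → R ⟨a, b⟩ ⟨a', b⟩)
    (hQ : ∀ a a' b b', Q b b' → R ⟨a, b⟩ ⟨a', b'⟩) {α γ : Ordinal.{u}} {T : Set B}
    (hA : RankGE P Set.univ α) (hB : RankGE Q T γ) :
    RankGE R {x : LexProd A B | x.snd ∈ T} (α * γ) := by
  induction γ using WellFoundedLT.induction generalizing T with
  | ind γ ih =>
    refine rankGE_iff.2 fun δ hδ ↦ ?_
    have hα : α ≠ 0 := by
      rintro rfl
      simp at hδ
    -- Choose `b` leaving rank `δ / α`: the fibre over `b` followed by the residual yields `α * (δ /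
    -- α) + α`, which exceeds `δ`.
    obtain ⟨b, hb, hb'⟩ := rankGE_iff.1 hB _ ((lt_mul_iff_div_lt hα).1 hδ)
    have hfib : RankGE R {x : LexProd A B | x.snd = b} α :=
      hA.of_map (fun a ↦ ⟨a, b⟩) (fun _ _ ↦ rfl) fun a a' ↦ hP a a' b
    have hun := hfib.union (ih _ ((lt_mul_iff_div_lt hα).1 hδ) hb') (by
      rintro ⟨a, _⟩ rfl ⟨a', b'⟩ h
      exact hQ _ _ _ _ h.2)
    have hun' : RankGE R {x : LexProd A B | x.snd ∈ T} (α * (δ / α) + α) := by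
      refine hun.mono ?_ le_rfl
      rintro ⟨a, b'⟩ (h | h)
      · exact (show b' = b from h) ▸ hb
      · exact h.1
    exact rankGE_iff.1 hun' δ (lt_mul_div_add δ hα)

theorem RankLE.lexProd {a γ : Ordinal.{u}} {T : Set B}
    (hA : RankLE (fun x y : A ↦ ¬ x ≤ y) Set.univ (ω ^ a))
    (hB : RankLE (fun x y : B ↦ ¬ x ≤ y) T γ) :
    RankLE (fun x y : lexProd A B ↦ ¬ x ≤ y) {x : LexProd A B | x.snd ∈ T} (ω ^ a * γ) := by
  induction γ using WellFoundedLT.induction generalizing T with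
  | ind γ ih =>
    refine rankLE_iff.2 fun x hx ↦ ?_
    obtain ⟨γ', hγ, hT⟩ := rankLE_iff.1 hB x.snd hx
    obtain ⟨ε, hε, hfst⟩ := rankLE_iff.1 hA x.fst (Set.mem_univ _)
    have hfib : RankLE (fun x y : WqoInvariants.lexProd A B ↦ ¬ x ≤ y)
        {z : LexProd A B | ¬ x.fst ≤ z.fst ∧ AntisymmRel (· ≤ ·) x.snd z.snd} ε := by
      refine hfst.of_rel (fun z a ↦ z.fst = a ∧ AntisymmRel (· ≤ ·) x.snd z.snd)
        (fun z hz ↦ ⟨z.fst, ⟨Set.mem_univ _, hz.1⟩, rfl, hz.2⟩) ?_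
      rintro z z' _ _ ⟨rfl, hz⟩ ⟨rfl, hz'⟩ h hle
      exact h ⟨hz.2.trans hz'.1, fun _ ↦ hle⟩
    have hlt : natAdd (ω ^ a * γ') ε < ω ^ a * γ :=
      (natAdd_lt_omega0_opow_mul
        ((mul_lt_mul_iff_right₀ (opow_pos a omega0_pos)).2 (lt_add_one γ')) hε).trans_le
        (mul_le_mul_right (Order.add_one_le_of_lt hγ) _)
    -- If `x ≰ z`, then either `x.snd ≰ z.snd`, or the second components are equivalent and `x.fst ≰
    -- z.fst`.
    refine ⟨_, hlt, ((ih γ' hγ hT).union hfib).mono (fun z hz ↦ ?_) le_rfl⟩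
    by_cases h : x.snd ≤ z.snd
    · refine Or.inr ?_
      by_contra hcon
      exact hz.2 ⟨h, fun hxz ↦ by_contra fun hn ↦ hcon ⟨hn, hxz⟩⟩
    · exact Or.inl ⟨hz.1, h⟩

end LexProd

/-! ### Wqos whose three invariants coincide -/

/-- Bounds on the ranks of sequences that force the height, the width and the maximal order type
of `A` to be equal to `δ`. -/
structure HasRank (A : Wqo.{u}) (δ : Ordinal.{u}) : Prop where
  bad : RankLE (fun x y : A ↦ ¬ x ≤ y) Set.univ δ
  decreasing : RankGE (fun x y : A ↦ y < x) Set.univ δ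
  antichain : RankGE (fun x y : A ↦ IncompRel (· ≤ ·) x y) Set.univ δ

theorem HasRank.invariants_eq {A : Wqo.{u}} {δ : Ordinal.{u}} (h : HasRank A δ) :
    height A = δ ∧ width A = δ ∧ maxOrderType A = δ := by
  refine ⟨le_antisymm (treeRank_le _ ?_) (le_treeRank _ h.decreasing),
    le_antisymm (treeRank_le _ ?_) (le_treeRank _ h.antichain),
    le_antisymm (treeRank_le _ h.bad) (le_treeRank _ ?_)⟩
  · exact h.bad.of_rel Eq (fun y _ ↦ ⟨y, trivial, rfl⟩) (by
      rintro y y' _ _ rfl rfl hlt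
      exact not_le_of_gt hlt)
  · exact h.bad.of_rel Eq (fun y _ ↦ ⟨y, trivial, rfl⟩) (by
      rintro y y' _ _ rfl rfl hinc
      exact hinc.1)
  · exact h.antichain.of_map id (fun _ _ ↦ trivial) fun _ _ hinc ↦ hinc.1

theorem HasRank.lexProd {A B : Wqo.{u}} {a γ : Ordinal.{u}} (hA : HasRank A (ω ^ a))
    (hB : HasRank B γ) : HasRank (lexProd A B) (ω ^ a * γ) where
  bad := hA.bad.lexProd hB.bad
  decreasing := by
    refine RankGE.lexProd (fun a a' b h ↦ ?_) (fun a a' b b' h ↦ ?_) hA.decreasing hB.decreasing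
    · exact lt_of_le_not_ge ⟨le_rfl, fun _ ↦ h.le⟩ fun hle ↦ h.not_ge (hle.2 AntisymmRel.rfl)
    · exact lt_of_le_not_ge ⟨h.le, fun hbb ↦ absurd hbb.2 h.not_ge⟩ fun hle ↦ h.not_ge hle.1
  antichain := by
    refine RankGE.lexProd (fun a a' b h ↦ ?_) (fun a a' b b' h ↦ ?_) hA.antichain hB.antichain
    · exact ⟨fun hle ↦ h.1 (hle.2 AntisymmRel.rfl), fun hle ↦ h.2 (hle.2 AntisymmRel.rfl)⟩
    · exact ⟨fun hle ↦ h.1 hle.1, fun hle ↦ h.2 hle.1⟩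

theorem hasRank_gamma_one : HasRank (Gamma.{u} 1) 1 := by
  have hpair : ∀ R : Gamma.{u} 1 → Gamma.{u} 1 → Prop, RankGE R Set.univ 1 := fun R ↦ by
    have := rankGE_of_pairwise (R := R) [(⟨0⟩ : Gamma.Carrier 1)] (List.pairwise_singleton _ _)
    exact this.mono (Set.subset_univ _) Nat.cast_one.ge
  refine ⟨?_, hpair _, hpair _⟩
  refine (rankLE_finset (fun x h ↦ h le_rfl) {(⟨0⟩ : Gamma.Carrier 1)}).mono (fun x _ ↦ ?_) (by simp)
  obtain ⟨i⟩ := x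
  simp [Subsingleton.elim i 0]

theorem HasRank.lexProdList {l : List Wqo.{u}} {e : List Ordinal.{u}}
    (h : List.Forall₂ (fun A a ↦ HasRank A (ω ^ a)) l e) :
    HasRank (lexProdList l) (ω ^ e.sum) := by
  induction h with
  | nil => simpa [WqoInvariants.lexProdList] using hasRank_gamma_one
  | @cons A a l e hA hl ih =>
    cases hl with
    | nil => simpa [WqoInvariants.lexProdList] using hA
    | cons hB hl =>
      rw [List.sum_cons, opow_add]
      exact hA.lexProd ih

/-! ### Lexicographic sums -/

section LexSumBasic

variable {ι : Type v} [LinearOrder ι] [WellFoundedLT ι] {A : ι → Wqo.{u}}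

/-- The element of `lexSum A` given by an element of `A i`. -/
def lexSum.mk (i : ι) (a : A i) : lexSum A :=
  (⟨i, a⟩ : Σₗ i, A i)

theorem lexSum.mk_le_mk {i : ι} {a b : A i} :
    lexSum.mk (A := A) i a ≤ lexSum.mk i b ↔ a ≤ b := by
  refine ⟨fun h ↦ ?_, fun h ↦ Sigma.Lex.right _ _ h⟩
  cases h with
  | left _ _ h => exact absurd h (lt_irrefl _)
  | right _ _ h => exact h

theorem lexSum.mk_lt_mk {i : ι} {a b : A i} :
    lexSum.mk (A := A) i a < lexSum.mk i b ↔ a < b := by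
  rw [lt_iff_le_not_ge, lt_iff_le_not_ge, mk_le_mk, mk_le_mk]

theorem lexSum.mk_incompRel_mk {i : ι} {a b : A i} :
    IncompRel (· ≤ ·) (lexSum.mk (A := A) i a) (lexSum.mk i b) ↔ IncompRel (· ≤ ·) a b :=
  and_congr (not_congr mk_le_mk) (not_congr mk_le_mk)

theorem lexSum.mk_lt_mk_of_lt {i j : ι} {a : A i} {b : A j} (h : i < j) :
    lexSum.mk (A := A) i a < lexSum.mk j b := by
  refine lt_of_le_not_ge (Sigma.Lex.left _ _ h) fun hle ↦ ?_
  cases hle with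
  | left _ _ h' => exact lt_asymm h h'
  | right _ _ _ => exact lt_irrefl _ h

theorem lexSum.fst_le_of_not_le {x y : lexSum A} (h : ¬ x ≤ y) : Sigma.fst y ≤ Sigma.fst x := by
  by_contra hlt
  exact h (Sigma.Lex.left _ _ (not_le.1 hlt))

end LexSumBasic

section LexSum

variable {ι : Type u} [LinearOrder ι] [WellFoundedLT ι] {A : ι → Wqo.{u}}

theorem RankLE.lexSum_fiber {i : ι} {δ : Ordinal.{u}}
    (h : RankLE (fun x y : A i ↦ ¬ x ≤ y) Set.univ δ) :
    RankLE (fun x y : lexSum A ↦ ¬ x ≤ y) {x | Sigma.fst x = i} δ := by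
  refine h.of_rel (fun y x ↦ y = ⟨i, x⟩) ?_ ?_
  · rintro ⟨_, x⟩ rfl
    exact ⟨x, trivial, rfl⟩
  · rintro _ _ x x' rfl rfl hR hle
    exact hR (Sigma.Lex.right _ _ hle)

/-- After `x`, a bad sequence stays in the fibre of `x` or in lower ones. Both parts have rank at
most `ω ^ f (Sigma.fst x)`, so their natural sum is below `ω ^ β`. -/
theorem RankLE.lexSum {f : ι → Ordinal.{u}} (hf : StrictMono f)
    (h : ∀ i, RankLE (fun x y : A i ↦ ¬ x ≤ y) Set.univ (ω ^ f i)) (β : Ordinal.{u}) :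
    RankLE (fun x y : lexSum A ↦ ¬ x ≤ y) {x | f (Sigma.fst x) < β} (ω ^ β) := by
  induction β using WellFoundedLT.induction with
  | ind β ih =>
    refine rankLE_iff.2 fun x (hx : f (Sigma.fst x) < β) ↦ ?_
    have hlt := (opow_lt_opow_iff_right one_lt_omega0).2 hx
    refine ⟨_, natAdd_lt_omega0_opow hlt hlt,
      ((ih _ hx).union (h (Sigma.fst x)).lexSum_fiber).mono (fun y hy ↦ ?_) le_rfl⟩
    exact (lexSum.fst_le_of_not_le hy.2).lt_or_eq.imp (fun h ↦ hf h) id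

/-- For limit `α`, any `δ < ω ^ α` lies below some `ω ^ β` with `β < α`; the summand of exponent `β`
alone gives the lower bounds. -/
theorem HasRank.lexSum {f : ι → Ordinal.{u}} (hf : StrictMono f) {α : Ordinal.{u}}
    (hα : Order.IsSuccLimit α) (hr : ∀ β, (∃ i, f i = β) ↔ β < α)
    (h : ∀ i, HasRank (A i) (ω ^ f i)) : HasRank (lexSum A) (ω ^ α) where
  bad := (RankLE.lexSum hf (fun i ↦ (h i).bad) α).mono
    (fun x _ ↦ (hr _).1 ⟨Sigma.fst x, rfl⟩) le_rfl
  decreasing := by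
    refine rankGE_iff.2 fun δ hδ ↦ ?_
    obtain ⟨β, hβ, hδβ⟩ := (lt_opow_of_isSuccLimit omega0_ne_zero hα).1 hδ
    obtain ⟨i, rfl⟩ := (hr β).2 hβ
    have hi : RankGE (fun x y : WqoInvariants.lexSum A ↦ y < x) Set.univ (ω ^ f i) :=
      (h i).decreasing.of_map (lexSum.mk i) (fun _ _ ↦ trivial) fun _ _ ↦ lexSum.mk_lt_mk.2
    exact rankGE_iff.1 hi δ hδβ
  antichain := by
    refine rankGE_iff.2 fun δ hδ ↦ ?_
    obtain ⟨β, hβ, hδβ⟩ := (lt_opow_of_isSuccLimit omega0_ne_zero hα).1 hδ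
    obtain ⟨i, rfl⟩ := (hr β).2 hβ
    have hi : RankGE (fun x y : WqoInvariants.lexSum A ↦ IncompRel (· ≤ ·) x y)
        Set.univ (ω ^ f i) :=
      (h i).antichain.of_map (lexSum.mk i) (fun _ _ ↦ trivial) fun _ _ ↦ lexSum.mk_incompRel_mk.2
    exact rankGE_iff.1 hi δ hδβ

end LexSum

theorem finite_fst_le_lexSum_gamma (n : ℕ) :
    {y : lexSum fun n : ℕ ↦ Gamma.{u} n | Sigma.fst y ≤ n}.Finite := by
  refine (Set.finite_range fun p : Σ k : Fin (n + 1), Fin k ↦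
    lexSum.mk (A := fun n : ℕ ↦ Gamma.{u} n) p.1 ⟨p.2⟩).subset ?_
  rintro ⟨k, i⟩ (hk : k ≤ n)
  exact ⟨⟨⟨k, Nat.lt_succ_of_le hk⟩, i.idx⟩, rfl⟩

theorem rankGE_omega0 {A : Type u} {R : A → A → Prop}
    (h : ∀ n : ℕ, ∃ l : List A, l.Pairwise R ∧ l.length = n) : RankGE R Set.univ ω := by
  refine rankGE_iff.2 fun δ hδ ↦ ?_
  obtain ⟨n, rfl⟩ := lt_omega0.1 hδ
  obtain ⟨l, hl, hn⟩ := h (n + 1)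
  exact rankGE_iff.1 ((rankGE_of_pairwise l hl).mono (Set.subset_univ _) le_rfl) _
    (Nat.cast_lt.2 (by omega))

theorem hasRank_lexSum_gamma : HasRank (lexSum fun n : ℕ ↦ Gamma.{u} n) ω where
  bad := by
    -- After the first element, only finitely many elements remain available.
    refine rankLE_iff.2 fun x _ ↦ ⟨_, natCast_lt_omega0 _,
      (rankLE_finset (fun x h ↦ h le_rfl)
        (finite_fst_le_lexSum_gamma (Sigma.fst x)).toFinset).mono (fun y hy ↦ ?_) le_rfl⟩
    simpa using lexSum.fst_le_of_not_le hy.2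
  decreasing := by
    -- The index is `k + 1` because the summand `Γ₀` is empty.
    refine rankGE_omega0 fun n ↦ ⟨(List.range n).reverse.map fun k ↦
      lexSum.mk (A := fun n : ℕ ↦ Gamma.{u} n) (k + 1) ⟨0⟩, ?_, by simp⟩
    rw [List.pairwise_map, List.pairwise_reverse]
    exact List.pairwise_lt_range.imp fun h ↦ lexSum.mk_lt_mk_of_lt (Nat.succ_lt_succ h)
  antichain := by
    refine rankGE_omega0 fun n ↦ ⟨List.ofFn fun i : Fin n ↦
      lexSum.mk (A := fun n : ℕ ↦ Gamma.{u} n) n ⟨i⟩, ?_, List.length_ofFn⟩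
    rw [List.pairwise_ofFn]
    exact fun i j hij ↦ lexSum.mk_incompRel_mk.2
      ⟨fun h ↦ hij.ne (congrArg Gamma.Carrier.idx h),
        fun h ↦ hij.ne' (congrArg Gamma.Carrier.idx h)⟩

theorem hasRank_famH (α : Ordinal.{u}) : HasRank (famH α) (ω ^ α) := by
  induction α using WellFoundedLT.induction with
  | ind α ih =>
    rw [famH]
    split_ifs with h0 h1 h
    · subst h0
      simpa using hasRank_gamma_one
    · subst h1
      simpa using hasRank_lexSum_gamma
    · obtain ⟨γ, hγ⟩ := h
      have hγ0 : γ ≠ 0 := by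
        rintro rfl
        exact h1 (by simpa using hγ)
      have hlim : Order.IsSuccLimit α := hγ ▸ isSuccLimit_opow_left isSuccLimit_omega0 hγ0
      refine HasRank.lexSum (f := fun β : α.ToType ↦ (ToType.toOrd β : Ordinal.{u}))
        (fun i j hij ↦ ToType.mk.symm.strictMono hij) hlim (fun β ↦ ⟨?_, fun hβ ↦ ?_⟩)
        fun i ↦ ih _ (ToType.toOrd i).2
      · rintro ⟨i, rfl⟩
        exact (ToType.toOrd i).2
      · exact ⟨ToType.mk ⟨β, hβ⟩, by simp⟩
    · have hsum := (cnfExponents_spec α).2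
      -- The factor for an exponent `e` has rank `ω ^ (ω ^ e)`, so the product has rank `ω` to the
      -- sum of the Cantor normal form terms, which is `α`.
      have hF : List.Forall₂ (fun A a ↦ HasRank A (ω ^ a))
          ((cnfExponents α).attach.map fun e ↦ famH (ω ^ e.1)) ((cnfExponents α).map (ω ^ ·)) := by
        conv => arg 3; rw [← List.attach_map_subtype_val (cnfExponents α)]
        rw [List.map_map, List.forall₂_map_left_iff, List.forall₂_map_right_iff,
          List.forall₂_same]
        exact fun e _ ↦ ih _ (opow_lt_of_mem_cnfExponents h e.2)
      have := HasRank.lexProdList hF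
      rwa [hsum] at this

end WqoInvariants

theorem mainTheorem6 (α : Ordinal.{u}) :
    WqoInvariants.height (WqoInvariants.famH α) = Ordinal.omega0 ^ α ∧
      WqoInvariants.width (WqoInvariants.famH α) = Ordinal.omega0 ^ α ∧
      WqoInvariants.maxOrderType (WqoInvariants.famH α) = Ordinal.omega0 ^ α :=
  (WqoInvariants.hasRank_famH α).invariants_eq
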